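/- Let $H$ be a real separable Hilbert space, let $d\ge 1$ be an integer with $d<\dim H$ (where $\dim H$ may be infinite), and write $B(x,t)$ for the closed ball with center $x$ and radius $t$. A locally finite Borel measure $\mu$ on $H$ is called $d$-regular if there is a constant $C\ge 1$ such that $$C^{-1}t^d\le \mu(B(x,t))\le C\,t^d\qquad\text{for all }x\in\operatorname{supp}\mu\text{ and all real } t \text{ with }0<t\le\operatorname{diam}(\operatorname{supp}\mu);$$ the smallest such $C$ is denoted by $C_\mu$. For $x\in\operatorname{supp}\mu$ and real $t$ with $0<t\le\operatorname{diam}(\operatorname{supp}\mu)$ put $$\beta_2^2(x,t)=\inf_{L}\ \int_{B(x,t)}\left(\frac{\operatorname{dist}(y,L)}{2t}\right)^2\frac{d\mu(y)}{\mu(B(x,t))},$$ the infimum being over all $d$-dimensional affine subspaces $L$ of $H$. For $X=(x_0,\dots,x_{d+1})\in H^{d+2}$ let $\operatorname{diam}(X)$ and $\min(X)$ be the largest and the smallest of the edge lengths $\|x_i-x_j\|$, $i\neq j$, let $M_{d+1}(X)$ be the $(d+1)$-dimensional volume of the parallelotope spanned by $x_1-x_0,\dots,x_{d+1}-x_0$,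 and let $$\operatorname{p}_d\!\sin_{x_i}(X)=\frac{M_{d+1}(X)}{\prod_{j\ne i}\|x_j-x_i\|},\qquad c_{\mathrm{MT}}(X)=\sqrt{\frac1{d+2}\cdot\frac1{\operatorname{diam}(X)^{d(d+1)}}\sum_{i=0}^{d+1}\operatorname{p}_d\!\sin_{x_i}^2(X)},$$ each being $0$ if a denominator vanishes. For $0<\lambda<2$ let $$c_{\mathrm{MT}}^2(x,t,\lambda)=\int_{\{X\in B(x,t)^{d+2}:\ \min(X)\ge\lambda t\}}c_{\mathrm{MT}}^2(X)\,d\mu^{d+2}(X).$$ **Theorem.** There exist constants $0<\lambda_0<2$ and $C_1\ge 1$, depending only on $d$ and $C_\mu$, such that for every $d$-regular measure $\mu$ on $H$ $$\beta_2^2(x,t)\cdot\mu(B(x,t))\le C_1\cdot c_{\mathrm{MT}}^2(x,t,\lambda_0)$$ for all $x\in\operatorname{supp}\mu$ and all real $t$ with $0<t\le\operatorname{diam}(\operatorname{supp}\mu)$. -/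

import Mathlib

open MeasureTheory

open scoped ENNReal

noncomputable section

namespace MengerCurvature

variable {H : Type*} [NormedAddCommGroup H]

/-- The two-sided bound `C⁻¹ tᵈ ≤ μ(B(x,t)) ≤ C tᵈ` with `C ≥ 1`, for all `x ∈ supp μ` and all
real `t` with `0 < t ≤ diam (supp μ)` (the diameter may be infinite). Balls are closed. -/
def IsRegularityBound [MeasurableSpace H] (d : ℕ) (μ : Measure H) (C : ℝ) : Prop :=
  1 ≤ C ∧ ∀ x ∈ μ.support, ∀ t : ℝ, 0 < t → ENNReal.ofReal t ≤ Metric.ediam μ.support →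
    ENNReal.ofReal (C⁻¹ * t ^ d) ≤ μ (Metric.closedBall x t) ∧
      μ (Metric.closedBall x t) ≤ ENNReal.ofReal (C * t ^ d)

/-- A `d`-regular (`d`-dimensional Ahlfors regular) measure: a locally finite Borel measure for
which some `C ≥ 1` satisfies the two-sided bound. -/
structure IsDRegular [MeasurableSpace H] (d : ℕ) (μ : Measure H) : Prop where
  locallyFinite : IsLocallyFiniteMeasure μ
  exists_bound : ∃ C : ℝ, IsRegularityBound d μ C

/-- The regularity constant `C_μ`: the smallest `C` in the two-sided bound. -/
def regularityConst [MeasurableSpace H] (d : ℕ) (μ : Measure H) : ℝ :=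
  sInf {C : ℝ | IsRegularityBound d μ C}

/-- The infimum defining the regularity constant is attained, so it really is the smallest
admissible constant. -/
theorem isLeast_regularityConst [MeasurableSpace H] {d : ℕ} {μ : Measure H}
    (h : IsDRegular d μ) :
    IsLeast {C : ℝ | IsRegularityBound d μ C} (regularityConst d μ) := by
  have hne : {C : ℝ | IsRegularityBound d μ C}.Nonempty := h.exists_bound
  have hbdd : BddBelow {C : ℝ | IsRegularityBound d μ C} := ⟨1, fun C hC => hC.1⟩
  have h1 : (1 : ℝ) ≤ regularityConst d μ := le_csInf hne fun C hC => hC.1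
  have h0 : regularityConst d μ ≠ 0 := by positivity
  obtain ⟨u, -, hu, huS⟩ := exists_seq_tendsto_sInf hne hbdd
  have hu' : Filter.Tendsto u Filter.atTop (nhds (regularityConst d μ)) := hu
  refine ⟨⟨h1, fun x hx t ht hd => ⟨?_, ?_⟩⟩, fun C hC => csInf_le hbdd hC⟩
  · exact le_of_tendsto (ENNReal.tendsto_ofReal ((hu'.inv₀ h0).mul_const (t ^ d)))
      (Filter.Eventually.of_forall fun n => ((huS n).2 x hx t ht hd).1)
  · exact ge_of_tendsto (ENNReal.tendsto_ofReal (hu'.mul_const (t ^ d)))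
      (Filter.Eventually.of_forall fun n => ((huS n).2 x hx t ht hd).2)

variable [InnerProductSpace ℝ H]

/-- The `n`-content `M_n(X)` of the simplex `X = (x₀, …, x_n)`: the `n`-volume of the
parallelotope spanned by `x₁ - x₀, …, x_n - x₀`, that is, the square root of the Gram determinant
of these vectors. -/
def content {n : ℕ} (X : Fin (n + 1) → H) : ℝ :=
  Real.sqrt (Matrix.gram ℝ fun i : Fin n => X i.succ - X 0).det

/-- The largest edge length of a simplex. -/
def maxEdge {m : ℕ} (X : Fin m → H) : ℝ := ⨆ p : Fin m × Fin m, dist (X p.1) (X p.2)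

/-- The smallest edge length of a simplex (with at least two vertices). -/
def minEdge {m : ℕ} (X : Fin m → H) : ℝ :=
  ⨅ p : {p : Fin m × Fin m // p.1 ≠ p.2}, dist (X p.1.1) (X p.1.2)

/-- The polar sine of the simplex `X = (x₀, …, x_{d+1})` at its vertex `x_i`
(zero if the denominator is zero). -/
def polarSine {d : ℕ} (X : Fin (d + 2) → H) (i : Fin (d + 2)) : ℝ :=
  content X / ∏ j ∈ Finset.univ.erase i, ‖X j - X i‖

/-- The discrete Menger-type curvature `c_MT(X)` of the simplex `X = (x₀, …, x_{d+1})`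
(zero if the denominator is zero). -/
def mengerCurv {d : ℕ} (X : Fin (d + 2) → H) : ℝ :=
  Real.sqrt (1 / ((d : ℝ) + 2) * (1 / maxEdge X ^ (d * (d + 1))) * ∑ i, polarSine X i ^ 2)

/-- `U_lam(B(x,t))`: the tuples in `B(x,t)^{d+2}` with all edge lengths at least `lam * t`. -/
def bigSimplices (d : ℕ) (x : H) (t lam : ℝ) : Set (Fin (d + 2) → H) :=
  {X | (∀ i, X i ∈ Metric.closedBall x t) ∧ lam * t ≤ minEdge X}

/-- The squared curvature `c_MT²(x,t,lam)` of `μ` at `B(x,t)`, with values in `[0,∞]`. -/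
def mengerCurvSq [MeasurableSpace H] (d : ℕ) (μ : Measure H) (x : H) (t lam : ℝ) : ℝ≥0∞ :=
  ∫⁻ X in bigSimplices d x t lam, ENNReal.ofReal (mengerCurv X ^ 2)
    ∂(Measure.pi fun _ : Fin (d + 2) => μ)

/-- An `n`-plane: an affine subspace of dimension `n`. -/
def IsPlane (n : ℕ) (L : AffineSubspace ℝ H) : Prop :=
  (L : Set H).Nonempty ∧ FiniteDimensional ℝ L.direction ∧ Module.finrank ℝ L.direction = n

open scoped Classical in
/-- The scaled least squares error `β₂(x,t)` of approximating `μ` by `d`-planes on `B(x,t)`, with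
values in `[0,∞]`; it is zero if `μ(B(x,t)) = 0`. The diameter of `B(x,t)` is `2t`. -/
def betaTwo [MeasurableSpace H] (d : ℕ) (μ : Measure H) (x : H) (t : ℝ) : ℝ≥0∞ :=
  if μ (Metric.closedBall x t) = 0 then 0 else
    ((⨅ L : {L : AffineSubspace ℝ H // IsPlane d L},
      (∫⁻ y in Metric.closedBall x t,
        ENNReal.ofReal ((Metric.infDist y (L.1 : Set H) / (2 * t)) ^ 2) ∂μ)
          / μ (Metric.closedBall x t))) ^ (1 / 2 : ℝ)

end MengerCurvature

end

/-!
Call a `(d + 2)`-tuple `X` in the ball `B = B(x, t)` spread at scale `r` if each vertex has distance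
at least `r` from the affine span of any `d` of the other vertices. The proof rests on two facts.

* *Most tuples are spread* (`IsRegularityBound.half_le_measure_isSpread`). By regularity a
  `t / N`-neighbourhood of an affine subspace of dimension `< d` has mass `≲ t ^ d / N` in `B`,
  since a grid of mesh `t / N` along the subspace covers its trace on `supp μ` by `≲ N ^ (d - 1)`
  balls of radius `≲ t / N` (`IsRegularityBound.measure_slab_le`). For large `N`, depending only on
  `d` and the regularity constant, a union bound over pairs of indices shows that at least half
  of `B ^ (d + 2)` is spread at scale `t / N`.
* *A pointwise comparison* (`IsSpread.ofReal_infDist_le`). Let `X` be spread, let `L` be the plane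
  through its first `d + 1` vertices and let `y ∈ B`. If `y` is far from these vertices, replacing
  the last vertex by `y` gives a simplex with content `≳ t ^ d * dist (y, L)`, so its curvature
  controls `dist (y, L)`. Otherwise `y` is close to exactly one vertex `X j` of `L`. Then it is far
  from the others, and replacing `X j` by `y` controls the distance of `y` to the plane `L'`
  through the vertices other than `X j`. The planes `L` and `L'` share a `(d - 1)`-plane from which
  the last vertex is far, so their angle is controlled by the distance of the last vertex to `L`
  (`infDist_le_of_hinge`), that is, by the curvature of `X` itself.

Integrating the comparison over `y ∈ B` and all spread `X`, the left side is at least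
`β₂² μ(B)` times the mass of the spread tuples, while resampling one coordinate only produces a
factor `μ(B)` on the right (`lintegral_pi_lintegral_update`). The powers of `t` cancel by
regularity.
-/

namespace MengerCurvature

/-! ### Contents of simplices -/

section Content

variable {H : Type*} [NormedAddCommGroup H] [InnerProductSpace ℝ H]

/-- The Gram matrix of linear combinations `∑ j, A i j • v j` is `A * G * Aᵀ`. -/
theorem gram_sum_smul {n : ℕ} (A : Matrix (Fin n) (Fin n) ℝ) (v : Fin n → H) :
    Matrix.gram ℝ (fun i => ∑ j, A i j • v j) = A * Matrix.gram ℝ v * A.transpose := by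
  ext i k
  simp only [Matrix.gram_apply, Matrix.mul_apply, Matrix.transpose_apply, sum_inner, inner_sum,
    inner_smul_left, inner_smul_right, Finset.sum_mul]
  refine Finset.sum_congr rfl fun j _ => ?_
  rw [Finset.mul_sum]
  refine Finset.sum_congr rfl fun l _ => ?_
  simp only [conj_trivial]
  ring

/-- The matrix expressing the edge vectors `X (σ i.succ) - X (σ 0)` of a relabelled simplex in
terms of the edge vectors `X j.succ - X 0`. -/
def relabelMatrix {n : ℕ} (σ : Fin (n + 1) → Fin (n + 1)) : Matrix (Fin n) (Fin n) ℝ :=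
  fun i j => (if σ i.succ = j.succ then 1 else 0) - (if σ 0 = j.succ then 1 else 0)

theorem sum_relabelMatrix_smul {n : ℕ} {V : Type*} [AddCommGroup V] [Module ℝ V]
    (σ : Fin (n + 1) → Fin (n + 1)) (f : Fin (n + 1) → V) (i : Fin n) :
    ∑ j, relabelMatrix σ i j • (f j.succ - f 0) = f (σ i.succ) - f (σ 0) := by
  have key : ∀ k : Fin (n + 1),
      ∑ j : Fin n, (if k = j.succ then (1 : ℝ) else 0) • (f j.succ - f 0) = f k - f 0 := by
    intro k
    induction k using Fin.cases with
    | zero => simp [fun j : Fin n => (Fin.succ_ne_zero j).symm]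
    | succ k => simp
  simp only [relabelMatrix, sub_smul, Finset.sum_sub_distrib, key]
  abel

theorem relabelMatrix_sq {n : ℕ} {σ : Fin (n + 1) → Fin (n + 1)}
    (hσ : Function.Involutive σ) : relabelMatrix σ * relabelMatrix σ = 1 := by
  ext i k
  have h := sum_relabelMatrix_smul σ (fun m => if σ m = k.succ then (1 : ℝ) else 0) i
  rw [Matrix.mul_apply]
  refine h.trans ?_
  simp only [hσ _, Matrix.one_apply, Fin.succ_inj, (Fin.succ_ne_zero k).symm, if_false, sub_zero]

/-- The content does not change when two vertices are exchanged, although the base point of the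
edge vectors may change. -/
theorem content_comp_swap {n : ℕ} (X : Fin (n + 1) → H) (a b : Fin (n + 1)) :
    content (X ∘ Equiv.swap a b) = content X := by
  have hσ : Function.Involutive (Equiv.swap a b) := fun i => by
    rw [← Equiv.trans_apply, Equiv.swap_swap, Equiv.refl_apply]
  have h1 : (fun i : Fin n => (X ∘ Equiv.swap a b) i.succ - (X ∘ Equiv.swap a b) 0) =
      fun i => ∑ j, relabelMatrix (Equiv.swap a b) i j • (X j.succ - X 0) := by
    funext i
    rw [sum_relabelMatrix_smul]
    rfl
  have h2 : (relabelMatrix (Equiv.swap a b)).det * (relabelMatrix (Equiv.swap a b)).det = 1 := by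
    rw [← Matrix.det_mul, relabelMatrix_sq hσ, Matrix.det_one]
  rw [content, content, h1, gram_sum_smul, Matrix.det_mul, Matrix.det_mul, Matrix.det_transpose,
    mul_right_comm, h2, one_mul]

/-- Gram determinants factor along the last vector: subtracting from it a combination of the
others so that the difference is orthogonal to them does not change the determinant. -/
theorem det_gram_eq_mul {n : ℕ} (v : Fin (n + 1) → H) (c : Fin n → ℝ)
    (h : ∀ j : Fin n,
      inner ℝ (v (Fin.last n) - ∑ i, c i • v i.castSucc) (v j.castSucc) = 0) :
    (Matrix.gram ℝ v).det =
      ‖v (Fin.last n) - ∑ i, c i • v i.castSucc‖ ^ 2 *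
        (Matrix.gram ℝ fun i : Fin n => v i.castSucc).det := by
  set w := v (Fin.last n) - ∑ i, c i • v i.castSucc with hw
  have hrow : (∑ k, (Fin.snoc (fun i => - c i) 1 : Fin (n + 1) → ℝ) k • Matrix.gram ℝ v k) =
      fun j => inner ℝ w (v j) := by
    funext j
    rw [Fin.sum_univ_castSucc]
    simp only [Fin.snoc_castSucc, Fin.snoc_last, Pi.add_apply, Finset.sum_apply, Pi.smul_apply,
      Matrix.gram_apply, smul_eq_mul, hw, inner_sub_left, sum_inner, inner_smul_left,
      conj_trivial, neg_mul, Finset.sum_neg_distrib]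
    ring
  have hlast : inner ℝ w (v (Fin.last n)) = ‖w‖ ^ 2 := by
    have : v (Fin.last n) = w + ∑ i, c i • v i.castSucc := by rw [hw]; abel
    rw [this, inner_add_right, real_inner_self_eq_norm_sq, inner_sum]
    simp [inner_smul_right, h]
  have h1 := Matrix.det_updateRow_sum (Matrix.gram ℝ v) (Fin.last n)
    (Fin.snoc (fun i => - c i) 1 : Fin (n + 1) → ℝ)
  rw [hrow, Fin.snoc_last, one_smul] at h1
  rw [← h1, Matrix.det_succ_row _ (Fin.last n), Fin.sum_univ_castSucc]
  simp only [Matrix.updateRow_self, h, hlast, mul_zero, zero_mul, Finset.sum_const_zero, zero_add]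
  have hsub : (Matrix.updateRow (Matrix.gram ℝ v) (Fin.last n)
      fun j => inner ℝ w (v j)).submatrix (Fin.last n).succAbove (Fin.last n).succAbove =
      Matrix.gram ℝ fun i : Fin n => v i.castSucc := by
    ext i j
    simp [Matrix.gram_apply, Matrix.updateRow_apply, (Fin.castSucc_lt_last i).ne]
  rw [hsub]
  simp [← two_mul, pow_mul]

/-- The content of a simplex is at least the content of a face times the height over that face
(equality holds, but only this direction is needed). -/
theorem content_castSucc_mul_infDist_le {n : ℕ} (X : Fin (n + 2) → H) :
    content (fun i : Fin (n + 1) => X i.castSucc) *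
        Metric.infDist (X (Fin.last (n + 1)))
          (affineSpan ℝ (Set.range fun i : Fin (n + 1) => X i.castSucc) : Set H) ≤
      content X := by
  set S := affineSpan ℝ (Set.range fun i : Fin (n + 1) => X i.castSucc) with hS
  set v : Fin (n + 1) → H := fun i => X i.succ - X 0 with hv
  set W := Submodule.span ℝ (Set.range fun i : Fin n => v i.castSucc) with hW
  have : FiniteDimensional ℝ W := FiniteDimensional.span_of_finite ℝ (Set.finite_range _)
  have hmem : (W.starProjection (v (Fin.last n)) : H) ∈ W := by simp
  obtain ⟨c, hc⟩ := (Submodule.mem_span_range_iff_exists_fun ℝ).1 hmem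
  have horth : ∀ j : Fin n,
      inner ℝ (v (Fin.last n) - ∑ i, c i • v i.castSucc) (v j.castSucc) = 0 := by
    intro j
    rw [hc]
    exact Submodule.starProjection_inner_eq_zero _ _ (Submodule.subset_span ⟨j, rfl⟩)
  have hdet := det_gram_eq_mul v c horth
  have hpt : (∑ i, c i • v i.castSucc) + X 0 ∈ S := by
    have h0 : X 0 ∈ S := subset_affineSpan ℝ _ ⟨0, rfl⟩
    refine AffineSubspace.vadd_mem_of_mem_direction
      (Submodule.sum_mem _ fun i _ => Submodule.smul_mem _ _ ?_) h0
    exact AffineSubspace.vsub_mem_direction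
      (subset_affineSpan ℝ _ ⟨i.succ, rfl⟩) h0
  have hdist : Metric.infDist (X (Fin.last (n + 1))) (S : Set H) ≤
      ‖v (Fin.last n) - ∑ i, c i • v i.castSucc‖ := by
    refine (Metric.infDist_le_dist_of_mem hpt).trans_eq ?_
    rw [dist_eq_norm, hv]
    simp only [Fin.succ_last]
    congr 1
    abel
  have hcont : content (fun i : Fin (n + 1) => X i.castSucc) =
      Real.sqrt (Matrix.gram ℝ fun i : Fin n => v i.castSucc).det := rfl
  have hcont' : content X = Real.sqrt (Matrix.gram ℝ v).det := rfl
  rw [hcont', hdet, Real.sqrt_mul (by positivity), Real.sqrt_sq (norm_nonneg _), ← hcont, mul_comm]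
  exact mul_le_mul_of_nonneg_right hdist (Real.sqrt_nonneg _)

theorem content_nonneg {n : ℕ} (X : Fin (n + 1) → H) : 0 ≤ content X := Real.sqrt_nonneg _

/-- If each vertex has distance at least `r` from the span of its predecessors, then the content
is at least `r ^ n`. -/
theorem pow_le_content {r : ℝ} (hr : 0 ≤ r) :
    ∀ {n : ℕ} (X : Fin (n + 1) → H),
      (∀ k : Fin (n + 1), k ≠ 0 →
        r ≤ Metric.infDist (X k) (affineSpan ℝ (X '' {i | i < k}) : Set H)) →
      r ^ n ≤ content X
  | 0, X, _ => by simp [content]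
  | n + 1, X, h => by
    refine le_trans ?_ (content_castSucc_mul_infDist_le X)
    rw [pow_succ]
    refine mul_le_mul (pow_le_content hr _ fun k hk => ?_) ?_ hr (content_nonneg _)
    · have := h k.castSucc (by simpa using hk)
      convert this using 4
      refine Set.ext fun p => ?_
      constructor
      · rintro ⟨i, hi, rfl⟩
        exact ⟨i.castSucc, by simpa using hi, rfl⟩
      · rintro ⟨i, hi, rfl⟩
        have hi' : i < Fin.last (n + 1) := lt_trans hi (Fin.castSucc_lt_last k)
        exact ⟨i.castPred hi'.ne, by simpa [Fin.castPred_lt_iff] using hi, by simp⟩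
    · have hset : (Set.range fun i : Fin (n + 1) => X i.castSucc) =
          X '' {i | i < Fin.last (n + 1)} := by
        ext p
        constructor
        · rintro ⟨i, rfl⟩
          exact ⟨i.castSucc, Fin.castSucc_lt_last i, rfl⟩
        · rintro ⟨i, hi, rfl⟩
          have hi' : i < Fin.last (n + 1) := hi
          exact ⟨i.castPred hi'.ne, by simp⟩
      rw [hset]
      exact h (Fin.last (n + 1)) Fin.last_pos.ne'

/-- Positive content means a nonzero Gram determinant, hence affinely independent vertices. -/
theorem isPlane_affineSpan_of_content_pos {n : ℕ} {X : Fin (n + 1) → H}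
    (h : 0 < content X) : IsPlane n (affineSpan ℝ (Set.range X)) := by
  have hdet : (Matrix.gram ℝ fun i : Fin n => X i.succ - X 0).det ≠ 0 :=
    (Real.sqrt_pos.1 h).ne'
  have hli := Matrix.linearIndependent_of_det_gram_ne_zero hdet
  refine ⟨⟨X 0, subset_affineSpan ℝ _ ⟨0, rfl⟩⟩, ?_, ?_⟩
  · rw [direction_affineSpan]
    exact finiteDimensional_vectorSpan_range ℝ X
  · have hspan : vectorSpan ℝ (Set.range X) =
        Submodule.span ℝ (Set.range fun i : Fin n => X i.succ - X 0) := by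
      rw [vectorSpan_range_eq_span_range_vsub_right ℝ X 0]
      refine le_antisymm (Submodule.span_le.2 ?_) (Submodule.span_mono ?_)
      · rintro _ ⟨i, rfl⟩
        induction i using Fin.cases with
        | zero => simp
        | succ i => exact Submodule.subset_span ⟨i, rfl⟩
      · rintro _ ⟨i, rfl⟩
        exact ⟨i.succ, rfl⟩
    rw [direction_affineSpan, hspan, finrank_span_eq_card hli, Fintype.card_fin]

/-- If `z` has distance at least `η` from `F`, the distance of `y` to `span (F ∪ {u})` is
controlled by its distance to `span (F ∪ {z})` and the distance of `z` to `span (F ∪ {u})`. -/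
theorem infDist_le_of_hinge {F L L' : AffineSubspace ℝ H} {y z o : H} {η : ℝ} (hη : 0 < η)
    (ho : o ∈ F) (hFL : F ≤ L) (hL' : L' = affineSpan ℝ (insert z (F : Set H)))
    (hz : η ≤ Metric.infDist z (F : Set H)) :
    Metric.infDist y (L : Set H) ≤
      Metric.infDist y (L' : Set H) +
        2 * Metric.infDist y (F : Set H) / η * Metric.infDist z (L : Set H) := by
  have hFL' : F ≤ L' := by
    rw [hL']
    exact (fun p hp => subset_affineSpan ℝ _ (Set.mem_insert_of_mem _ hp))
  have hne' : (L' : Set H).Nonempty := ⟨o, hFL' ho⟩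
  have hneF : (F : Set H).Nonempty := ⟨o, ho⟩
  have hneL : (L : Set H).Nonempty := ⟨o, hFL ho⟩
  -- every point `q` of `L'` gives the estimate with `dist y q` in place of `infDist y L'`
  have key : ∀ q ∈ L', Metric.infDist y (L : Set H) ≤
      dist y q + (dist y q + Metric.infDist y (F : Set H)) / η *
        Metric.infDist z (L : Set H) := by
    intro q hq
    rw [hL', AffineSubspace.mem_affineSpan_insert_iff ho] at hq
    obtain ⟨a, f, hf, rfl⟩ := hq
    simp only [vsub_eq_sub, vadd_eq_add]
    set q := a • (z - o) + f
    -- the height of `q` over `F` is `|a|` times that of `z`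
    have h1 : |a| * η ≤ Metric.infDist q (F : Set H) := by
      refine (Metric.le_infDist hneF).2 fun {p} hp => ?_
      rcases eq_or_ne a 0 with rfl | ha
      · simp
      have hp' : o + a⁻¹ • (p - f) ∈ F := by
        rw [add_comm]
        exact AffineSubspace.vadd_mem_of_mem_direction
          (Submodule.smul_mem _ _ (AffineSubspace.vsub_mem_direction hp hf)) ho
      have h2 : q - p = a • (z - (o + a⁻¹ • (p - f))) := by
        simp only [q, smul_sub, smul_add, smul_smul, mul_inv_cancel₀ ha, one_smul]
        abel
      rw [dist_eq_norm, h2, norm_smul, Real.norm_eq_abs, ← dist_eq_norm]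
      gcongr
      exact hz.trans (Metric.infDist_le_dist_of_mem hp')
    have h2 : |a| ≤ (dist y q + Metric.infDist y (F : Set H)) / η := by
      rw [le_div_iff₀ hη]
      refine h1.trans ?_
      rw [add_comm, dist_comm]
      exact Metric.infDist_le_infDist_add_dist
    have h3 : Metric.infDist q (L : Set H) ≤ |a| * Metric.infDist z (L : Set H) := by
      refine le_of_forall_pos_le_add fun ε hε => ?_
      obtain ⟨w, hw, hzw⟩ := (Metric.infDist_lt_iff hneL).1
        (lt_add_of_pos_right (Metric.infDist z (L : Set H)) (show 0 < ε / (|a| + 1) by positivity))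
      have hmem : a • (w - o) + f ∈ L :=
        AffineSubspace.vadd_mem_of_mem_direction
          (Submodule.smul_mem _ _ (AffineSubspace.vsub_mem_direction hw (hFL ho))) (hFL hf)
      refine (Metric.infDist_le_dist_of_mem hmem).trans ?_
      have h4 : q - (a • (w - o) + f) = a • (z - w) := by
        simp only [q, smul_sub]
        abel
      rw [dist_eq_norm, h4, norm_smul, Real.norm_eq_abs, ← dist_eq_norm]
      calc |a| * dist z w ≤ |a| * (Metric.infDist z (L : Set H) + ε / (|a| + 1)) := by gcongr
        _ = |a| * Metric.infDist z (L : Set H) + ε * (|a| / (|a| + 1)) := by ring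
        _ ≤ |a| * Metric.infDist z (L : Set H) + ε * 1 := by
          gcongr
          exact div_le_one_of_le₀ (by linarith) (by positivity)
        _ = _ := by ring
    calc Metric.infDist y (L : Set H) ≤ Metric.infDist q (L : Set H) + dist y q :=
          Metric.infDist_le_infDist_add_dist
      _ ≤ |a| * Metric.infDist z (L : Set H) + dist y q := by gcongr
      _ ≤ (dist y q + Metric.infDist y (F : Set H)) / η * Metric.infDist z (L : Set H)
          + dist y q := by gcongr; exact Metric.infDist_nonneg
      _ = _ := by ring
  have hle : Metric.infDist y (L' : Set H) ≤ Metric.infDist y (F : Set H) :=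
    Metric.infDist_le_infDist_of_subset hFL' hneF
  set D := Metric.infDist z (L : Set H) with hD
  have hD0 : 0 ≤ D := Metric.infDist_nonneg
  refine le_of_forall_pos_le_add fun ε hε => ?_
  have hK : 0 < 1 + D / η := by positivity
  obtain ⟨q, hq, hyq⟩ := (Metric.infDist_lt_iff hne').1
    (lt_add_of_pos_right (Metric.infDist y (L' : Set H)) (div_pos hε hK))
  refine (key q hq).trans ?_
  have hε' : ε / (1 + D / η) * (1 + D / η) = ε := div_mul_cancel₀ _ hK.ne'
  set e := ε / (1 + D / η)
  calc dist y q + (dist y q + Metric.infDist y (F : Set H)) / η * D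
      ≤ (Metric.infDist y (L' : Set H) + e) +
        ((Metric.infDist y (F : Set H) + e) + Metric.infDist y (F : Set H)) / η * D := by
        gcongr
        exact hyq.le.trans (by gcongr)
    _ = Metric.infDist y (L' : Set H) + 2 * Metric.infDist y (F : Set H) / η * D +
        e * (1 + D / η) := by ring
    _ = _ := by rw [hε']

end Content

/-! ### Spread simplices and the pointwise comparison -/

section Spread

variable {H : Type*} [NormedAddCommGroup H] [InnerProductSpace ℝ H] {d : ℕ}

/-- Every vertex of `X` has distance at least `r` from the affine span of any `d` of the other
`d + 1` vertices. Equivalently, in each facet of `X` all heights are at least `r`. -/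
def IsSpread (r : ℝ) (X : Fin (d + 2) → H) : Prop :=
  ∀ k j, k ≠ j → r ≤ Metric.infDist (X k) (affineSpan ℝ (X '' {k, j}ᶜ) : Set H)

theorem exists_ne_ne (hd : 1 ≤ d) (k j : Fin (d + 2)) : ∃ i, i ≠ k ∧ i ≠ j := by
  have hc : 2 < Fintype.card (Fin (d + 2)) := by simp; omega
  obtain ⟨i, hi⟩ := Finset.exists_mem_notMem_of_card_lt_card
    (s := ({k, j} : Finset (Fin (d + 2)))) (t := Finset.univ)
    (lt_of_le_of_lt Finset.card_le_two (by simpa using hc))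
  exact ⟨i, by simpa [not_or] using hi⟩

theorem IsSpread.le_dist (hd : 1 ≤ d) {r : ℝ} {X : Fin (d + 2) → H} (hX : IsSpread r X)
    {k i : Fin (d + 2)} (h : k ≠ i) : r ≤ dist (X k) (X i) := by
  obtain ⟨j, hjk, hji⟩ := exists_ne_ne hd k i
  refine (hX k j hjk.symm).trans (Metric.infDist_le_dist_of_mem ?_)
  exact subset_affineSpan ℝ _ ⟨i, by simp [h.symm, hji.symm], rfl⟩

theorem range_swap_last {Y : Type*} (X : Fin (d + 2) → Y) (j : Fin (d + 2)) :
    (Set.range fun i : Fin (d + 1) => X (Equiv.swap j (Fin.last (d + 1)) i.castSucc)) =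
      X '' {j}ᶜ := by
  ext p
  constructor
  · rintro ⟨i, rfl⟩
    refine ⟨_, ?_, rfl⟩
    intro h
    have h' : Equiv.swap j (Fin.last (d + 1)) i.castSucc = j := h
    rw [Equiv.swap_apply_eq_iff, Equiv.swap_apply_left] at h'
    exact (Fin.castSucc_lt_last i).ne h'
  · rintro ⟨m, hm, rfl⟩
    have hne : Equiv.swap j (Fin.last (d + 1)) m ≠ Fin.last (d + 1) := by
      intro h
      rw [Equiv.swap_apply_eq_iff, Equiv.swap_apply_right] at h
      exact hm h
    exact ⟨(Equiv.swap j (Fin.last (d + 1)) m).castPred hne, by simp⟩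

/-- The facets of a spread simplex have large content. -/
theorem IsSpread.pow_le_content_facet {r : ℝ} (hr : 0 ≤ r) {X : Fin (d + 2) → H}
    (hX : IsSpread r X) (j : Fin (d + 2)) :
    r ^ d ≤
      content fun i : Fin (d + 1) => X (Equiv.swap j (Fin.last (d + 1)) i.castSucc) := by
  set s : Fin (d + 1) → Fin (d + 2) := fun i => Equiv.swap j (Fin.last (d + 1)) i.castSucc with hs
  have hinj : Function.Injective s :=
    (Equiv.swap j (Fin.last (d + 1))).injective.comp (Fin.castSucc_injective _)
  have hsj : ∀ i, s i ≠ j := fun i h => by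
    rw [hs] at h
    simp only [Equiv.swap_apply_eq_iff, Equiv.swap_apply_left] at h
    exact (Fin.castSucc_lt_last i).ne h
  refine pow_le_content hr _ fun k hk => (hX (s k) j (hsj k)).trans ?_
  refine Metric.infDist_le_infDist_of_subset (affineSpan_mono ℝ ?_) ?_
  · rintro _ ⟨i, hi, rfl⟩
    exact ⟨s i, by simp [hinj.eq_iff, hsj i, (show i < k from hi).ne], rfl⟩
  · exact ⟨X (s 0), subset_affineSpan ℝ _ ⟨0, Fin.pos_iff_ne_zero.2 hk, rfl⟩⟩

theorem IsSpread.isPlane {r : ℝ} (hr : 0 < r) {X : Fin (d + 2) → H}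
    (hX : IsSpread r X) (j : Fin (d + 2)) : IsPlane d (affineSpan ℝ (X '' {j}ᶜ)) := by
  rw [← range_swap_last]
  exact isPlane_affineSpan_of_content_pos
    ((pow_pos hr d).trans_le (hX.pow_le_content_facet hr.le j))

/-- Replacing one vertex of a spread simplex by `y` gives a simplex whose content controls the
distance of `y` to the opposite facet. -/
theorem IsSpread.pow_mul_infDist_le_content {r : ℝ} (hr : 0 ≤ r) {X : Fin (d + 2) → H}
    (hX : IsSpread r X) (j : Fin (d + 2)) (y : H) :
    r ^ d * Metric.infDist y (affineSpan ℝ (X '' {j}ᶜ) : Set H) ≤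
      content (Function.update X j y) := by
  rw [← content_comp_swap _ j (Fin.last (d + 1))]
  refine le_trans ?_ (content_castSucc_mul_infDist_le _)
  have h1 : (fun i : Fin (d + 1) =>
      (Function.update X j y ∘ Equiv.swap j (Fin.last (d + 1))) i.castSucc) =
      fun i : Fin (d + 1) => X (Equiv.swap j (Fin.last (d + 1)) i.castSucc) := by
    funext i
    rw [Function.comp_apply, Function.update_of_ne]
    intro h
    rw [Equiv.swap_apply_eq_iff, Equiv.swap_apply_left] at h
    exact (Fin.castSucc_lt_last i).ne h
  rw [h1, range_swap_last, Function.comp_apply, Equiv.swap_apply_right, Function.update_self]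
  exact mul_le_mul_of_nonneg_right (hX.pow_le_content_facet hr j) Metric.infDist_nonneg

theorem le_minEdge_iff {E : Type*} [NormedAddCommGroup E] {X : Fin (d + 2) → E} {a : ℝ} :
    a ≤ minEdge X ↔ ∀ p q, p ≠ q → a ≤ dist (X p) (X q) := by
  have hne : Nonempty {p : Fin (d + 2) × Fin (d + 2) // p.1 ≠ p.2} :=
    ⟨⟨(0, 1), by simp⟩⟩
  rw [minEdge, le_ciInf_iff (Set.finite_range _).bddBelow]
  exact ⟨fun h p q hpq => h ⟨(p, q), hpq⟩, fun h p => h _ _ p.2⟩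

/-- In a ball of radius `t`, the curvature of a simplex with distinct vertices controls its
content. -/
theorem content_sq_le_mengerCurv_sq {X : Fin (d + 2) → H} {x : H} {t : ℝ} (ht : 0 < t)
    (hX : ∀ i, X i ∈ Metric.closedBall x t) (hne : ∀ p q, p ≠ q → X p ≠ X q) :
    content X ^ 2 ≤ (2 * t) ^ ((d + 1) * (d + 2)) * mengerCurv X ^ 2 := by
  have hdist : ∀ p q, dist (X p) (X q) ≤ 2 * t := fun p q => by
    have := dist_triangle_right (X p) (X q) x
    have h1 := Metric.mem_closedBall.1 (hX p)
    have h2 := Metric.mem_closedBall.1 (hX q)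
    linarith
  have hmax : maxEdge X ≤ 2 * t := ciSup_le fun p => hdist _ _
  have hmax0 : 0 < maxEdge X :=
    (dist_pos.2 (hne 0 1 (by simp))).trans_le
      (le_ciSup (f := fun p : Fin (d + 2) × Fin (d + 2) => dist (X p.1) (X p.2))
        (Set.finite_range _).bddAbove (0, 1))
  have hsin : ∀ i, content X ^ 2 / (2 * t) ^ (2 * (d + 1)) ≤ polarSine X i ^ 2 := fun i => by
    have hprod : ∏ j ∈ Finset.univ.erase i, ‖X j - X i‖ ≤ (2 * t) ^ (d + 1) := by
      refine (Finset.prod_le_prod (g := fun _ => 2 * t) (fun _ _ => norm_nonneg _)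
        fun j _ => ?_).trans_eq ?_
      · rw [← dist_eq_norm]
        exact hdist _ _
      · simp [Finset.card_erase_of_mem]
    have hprod0 : 0 < ∏ j ∈ Finset.univ.erase i, ‖X j - X i‖ :=
      Finset.prod_pos fun j hj =>
        norm_pos_iff.2 (sub_ne_zero.2 (hne _ _ (Finset.ne_of_mem_erase hj)))
    rw [polarSine, div_pow, mul_comm 2 (d + 1), pow_mul]
    gcongr
  have hsum : ((d : ℝ) + 2) * (content X ^ 2 / (2 * t) ^ (2 * (d + 1))) ≤
      ∑ i, polarSine X i ^ 2 := by
    have := Finset.sum_le_sum fun i (_ : i ∈ (Finset.univ : Finset (Fin (d + 2)))) => hsin i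
    simpa using this
  have hpow : maxEdge X ^ (d * (d + 1)) ≤ (2 * t) ^ (d * (d + 1)) := by gcongr
  have hsq : mengerCurv X ^ 2 =
      1 / ((d : ℝ) + 2) * (1 / maxEdge X ^ (d * (d + 1))) * ∑ i, polarSine X i ^ 2 :=
    Real.sq_sqrt (by positivity)
  rw [hsq]
  calc content X ^ 2
      = (2 * t) ^ ((d + 1) * (d + 2)) * (1 / ((d : ℝ) + 2) * (1 / (2 * t) ^ (d * (d + 1))) *
          (((d : ℝ) + 2) * (content X ^ 2 / (2 * t) ^ (2 * (d + 1))))) := by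
        have : (2 * t) ^ ((d + 1) * (d + 2)) =
            (2 * t) ^ (d * (d + 1)) * (2 * t) ^ (2 * (d + 1)) := by
          rw [← pow_add]
          ring_nf
        rw [this]
        field_simp
    _ ≤ _ := by gcongr

/-- The integrand of `mengerCurvSq`, extended by zero outside `bigSimplices`. -/
noncomputable def curvIntegrand (d : ℕ) (x : H) (t lam : ℝ) : (Fin (d + 2) → H) → ℝ≥0∞ :=
  (bigSimplices d x t lam).indicator fun X => ENNReal.ofReal (mengerCurv X ^ 2)

/-- The constant in the comparison of the squared distance to a facet with the curvature. -/
noncomputable def facetConst (d : ℕ) (t δ : ℝ) : ℝ :=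
  2 ^ (d * (d + 3)) * t ^ (d * (d + 1)) / δ ^ (2 * d)

theorem IsSpread.ofReal_infDist_facet_le {x : H} {t δ lam : ℝ} (ht : 0 < t) (hδ : 0 < δ)
    (hlam : 0 < lam) {X : Fin (d + 2) → H} (hX : IsSpread (δ * t) X) (j : Fin (d + 2)) (y : H)
    (hmem : Function.update X j y ∈ bigSimplices d x t lam) :
    ENNReal.ofReal ((Metric.infDist y (affineSpan ℝ (X '' {j}ᶜ) : Set H) / (2 * t)) ^ 2) ≤
      ENNReal.ofReal (facetConst d t δ) * curvIntegrand d x t lam (Function.update X j y) := by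
  have hcont := content_sq_le_mengerCurv_sq ht hmem.1 fun p q hpq h => by
    have := le_minEdge_iff.1 hmem.2 p q hpq
    rw [h, dist_self] at this
    exact absurd (mul_pos hlam ht) this.not_gt
  have hlow := hX.pow_mul_infDist_le_content (by positivity) j y
  rw [curvIntegrand, Set.indicator_of_mem hmem, ← ENNReal.ofReal_mul
    (by unfold facetConst; positivity)]
  refine ENNReal.ofReal_le_ofReal ?_
  set I := Metric.infDist y (affineSpan ℝ (X '' {j}ᶜ) : Set H)
  have hI : 0 ≤ I := Metric.infDist_nonneg
  have h1 : ((δ * t) ^ d * I) ^ 2 ≤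
      (2 * t) ^ ((d + 1) * (d + 2)) * mengerCurv (Function.update X j y) ^ 2 :=
    (pow_le_pow_left₀ (by positivity) hlow 2).trans hcont
  set c := mengerCurv (Function.update X j y)
  have e1 : (I / (2 * t)) ^ 2 = ((δ * t) ^ d * I) ^ 2 / ((δ * t) ^ (2 * d) * (2 * t) ^ 2) := by
    rw [mul_pow, ← pow_mul, mul_comm d 2]
    field_simp
  have e2 : facetConst d t δ * c ^ 2 =
      (2 * t) ^ ((d + 1) * (d + 2)) * c ^ 2 / ((δ * t) ^ (2 * d) * (2 * t) ^ 2) := by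
    have : (2 * t) ^ ((d + 1) * (d + 2)) =
        2 ^ (d * (d + 3)) * t ^ (d * (d + 1)) * t ^ (2 * d) * (2 * t) ^ 2 := by
      rw [mul_pow, mul_pow]
      have a1 : (d + 1) * (d + 2) = d * (d + 3) + 2 := by ring
      have a2 : d * (d + 3) = d * (d + 1) + 2 * d := by ring
      rw [a1, pow_add, pow_add t, a2, pow_add t]
      ring
    rw [this, facetConst, mul_pow δ]
    field_simp
  rw [e1, e2]
  gcongr

/-- The pointwise comparison: for a spread simplex `X` in the ball, the squared distance of any
point `y` of the ball to the plane of the first `d + 1` vertices is controlled by the curvatures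
of `X` and of the simplices obtained from `X` by replacing one vertex by `y`. -/
theorem IsSpread.ofReal_infDist_le (hd : 1 ≤ d) {x : H} {t δ : ℝ} (ht : 0 < t) (hδ : 0 < δ)
    {X : Fin (d + 2) → H} (hX : IsSpread (δ * t) X) (hXB : ∀ i, X i ∈ Metric.closedBall x t)
    {y : H} (hy : y ∈ Metric.closedBall x t) :
    ENNReal.ofReal ((Metric.infDist y
        (affineSpan ℝ (X '' {Fin.last (d + 1)}ᶜ) : Set H) / (2 * t)) ^ 2) ≤
      ENNReal.ofReal ((2 + 32 / δ ^ 2) * facetConst d t δ) *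
        (curvIntegrand d x t (δ / 2) X +
          ∑ j, curvIntegrand d x t (δ / 2) (Function.update X j y)) := by
  have hlam : 0 < δ / 2 := by positivity
  have hA : 0 ≤ facetConst d t δ := by unfold facetConst; positivity
  have hδt : δ / 2 * t ≤ δ * t := by nlinarith [mul_pos hδ ht]
  set l := Fin.last (d + 1)
  set g := curvIntegrand d x t (δ / 2)
  -- replacing `X j` by `y` is admissible as soon as `y` is far from the other vertices
  have hupd : ∀ j, (∀ i, i ≠ j → δ / 2 * t ≤ dist y (X i)) →
      Function.update X j y ∈ bigSimplices d x t (δ / 2) := by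
    intro j hj
    refine ⟨fun i => ?_, le_minEdge_iff.2 fun p q hpq => ?_⟩
    · rcases eq_or_ne i j with rfl | h
      · simpa using hy
      · simpa [h] using hXB i
    · rcases eq_or_ne p j with rfl | hp
      · simpa [hpq.symm] using hj q hpq.symm
      · rcases eq_or_ne q j with rfl | hq
        · simpa [hp, dist_comm] using hj p hp
        · simpa [hp, hq] using hδt.trans (hX.le_dist hd hpq)
  have hterm : ∀ j, g (Function.update X j y) ≤
      g X + ∑ j, g (Function.update X j y) := fun j =>
    (Finset.single_le_sum (f := fun j => g (Function.update X j y)) (fun _ _ => zero_le)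
      (Finset.mem_univ j)).trans le_add_self
  have hconst : facetConst d t δ ≤ (2 + 32 / δ ^ 2) * facetConst d t δ := by
    have : 0 ≤ 32 / δ ^ 2 := by positivity
    nlinarith
  by_cases hnear : ∀ i, i ≠ l → δ / 2 * t ≤ dist y (X i)
  · refine (hX.ofReal_infDist_facet_le ht hδ hlam l y (hupd l hnear)).trans ?_
    exact mul_le_mul' (ENNReal.ofReal_le_ofReal hconst) (hterm l)
  · push Not at hnear
    obtain ⟨j, hjl, hj⟩ := hnear
    -- `y` is close to `X j`, hence far from the other vertices
    have hfar : ∀ i, i ≠ j → δ / 2 * t ≤ dist y (X i) := by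
      intro i hij
      have h1 := hX.le_dist hd hij.symm
      have h2 := dist_triangle_left (X j) (X i) y
      linarith
    have hXmem : Function.update X l (X l) ∈ bigSimplices d x t (δ / 2) := by
      rw [Function.update_eq_self]
      exact ⟨hXB, le_minEdge_iff.2 fun p q hpq => hδt.trans (hX.le_dist hd hpq)⟩
    have hI := hX.ofReal_infDist_facet_le ht hδ hlam j y (hupd j hfar)
    have hD := hX.ofReal_infDist_facet_le ht hδ hlam l (X l) hXmem
    rw [Function.update_eq_self] at hD
    obtain ⟨o, hol, hoj⟩ := exists_ne_ne hd l j
    have ho : X o ∈ affineSpan ℝ (X '' {l, j}ᶜ) :=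
      subset_affineSpan ℝ _ ⟨o, by simp [hol, hoj], rfl⟩
    have hins : affineSpan ℝ (X '' {j}ᶜ) =
        affineSpan ℝ (insert (X l) (affineSpan ℝ (X '' {l, j}ᶜ) : Set H)) := by
      rw [affineSpan_insert_affineSpan, ← Set.image_insert_eq]
      congr 2
      ext i
      by_cases h : i = l
      · simp [h, hjl.symm]
      · simp [h]
    have hinge := infDist_le_of_hinge (y := y) (z := X l)
      (L := affineSpan ℝ (X '' {l}ᶜ)) (mul_pos hδ ht) ho
      (affineSpan_mono ℝ (Set.image_mono (by simp))) hins (hX l j hjl.symm)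
    have hyF : Metric.infDist y (affineSpan ℝ (X '' {l, j}ᶜ) : Set H) ≤ 2 * t := by
      refine (Metric.infDist_le_dist_of_mem ho).trans ?_
      have h1 := dist_triangle_right y (X o) x
      have h2 := Metric.mem_closedBall.1 hy
      have h3 := Metric.mem_closedBall.1 (hXB o)
      linarith
    set I := Metric.infDist y (affineSpan ℝ (X '' {j}ᶜ) : Set H)
    set D := Metric.infDist (X l) (affineSpan ℝ (X '' {l}ᶜ) : Set H)
    set E := Metric.infDist y (affineSpan ℝ (X '' {l}ᶜ) : Set H)
    have hI0 : 0 ≤ I := Metric.infDist_nonneg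
    have hD0 : 0 ≤ D := Metric.infDist_nonneg
    have hE0 : 0 ≤ E := Metric.infDist_nonneg
    have hE : E ≤ I + 4 / δ * D := by
      refine hinge.trans ?_
      have : 2 * Metric.infDist y (affineSpan ℝ (X '' {l, j}ᶜ) : Set H) / (δ * t) ≤ 4 / δ := by
        rw [div_le_div_iff₀ (by positivity) hδ]
        nlinarith
      gcongr
    have hsq : (E / (2 * t)) ^ 2 ≤ 2 * (I / (2 * t)) ^ 2 + 32 / δ ^ 2 * (D / (2 * t)) ^ 2 := by
      have h1 : E / (2 * t) ≤ I / (2 * t) + 4 / δ * (D / (2 * t)) := by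
        rw [← mul_div_assoc, ← add_div]
        gcongr
      have h2 : (E / (2 * t)) ^ 2 ≤ (I / (2 * t) + 4 / δ * (D / (2 * t))) ^ 2 := by gcongr
      have h3 : 32 / δ ^ 2 * (D / (2 * t)) ^ 2 = 2 * (4 / δ * (D / (2 * t))) ^ 2 := by
        field_simp
        ring
      rw [h3]
      nlinarith [sq_nonneg (I / (2 * t) - 4 / δ * (D / (2 * t)))]
    calc ENNReal.ofReal ((E / (2 * t)) ^ 2)
        ≤ ENNReal.ofReal (2 * (I / (2 * t)) ^ 2 + 32 / δ ^ 2 * (D / (2 * t)) ^ 2) :=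
          ENNReal.ofReal_le_ofReal hsq
      _ = ENNReal.ofReal 2 * ENNReal.ofReal ((I / (2 * t)) ^ 2) +
            ENNReal.ofReal (32 / δ ^ 2) * ENNReal.ofReal ((D / (2 * t)) ^ 2) := by
          rw [ENNReal.ofReal_add (by positivity) (by positivity),
            ENNReal.ofReal_mul (by positivity), ENNReal.ofReal_mul (by positivity)]
      _ ≤ ENNReal.ofReal 2 * (ENNReal.ofReal (facetConst d t δ) *
              (g X + ∑ j, g (Function.update X j y))) +
            ENNReal.ofReal (32 / δ ^ 2) * (ENNReal.ofReal (facetConst d t δ) *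
              (g X + ∑ j, g (Function.update X j y))) := by
          gcongr
          · exact hI.trans (mul_le_mul' le_rfl (hterm j))
          · exact hD.trans (mul_le_mul' le_rfl le_self_add)
      _ = _ := by
          rw [ENNReal.ofReal_mul (by positivity), ENNReal.ofReal_add (by positivity)
            (by positivity)]
          ring

end Spread

/-! ### Resampling a coordinate of a product measure -/

section Tonelli

/-- Resampling one coordinate: integrating out the replaced value as well only produces the
factor `μ univ`. -/
theorem lintegral_pi_lintegral_update {ι α : Type*} [Fintype ι] [DecidableEq ι]
    [MeasurableSpace α] (μ : Measure α) [SigmaFinite μ] {f : (ι → α) → ℝ≥0∞} (hf : Measurable f)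
    (i : ι) :
    ∫⁻ X, ∫⁻ y, f (Function.update X i y) ∂μ ∂(Measure.pi fun _ : ι => μ) =
      μ Set.univ * ∫⁻ X, f X ∂(Measure.pi fun _ : ι => μ) := by
  rcases isEmpty_or_nonempty (ι → α) with h | ⟨⟨x⟩⟩
  · simp [lintegral_of_isEmpty]
  have hg : Measurable (∫⋯∫⁻_{i}, f ∂fun _ : ι => μ) := hf.lmarginal _
  have h1 : (fun X => ∫⁻ y, f (Function.update X i y) ∂μ) = ∫⋯∫⁻_{i}, f ∂fun _ : ι => μ :=
    (lmarginal_singleton (μ := fun _ : ι => μ) f i).symm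
  rw [h1, lintegral_eq_lmarginal_univ (μ := fun _ : ι => μ) x,
    lintegral_eq_lmarginal_univ (μ := fun _ : ι => μ) x,
    lmarginal_erase' (μ := fun _ : ι => μ) f hf (Finset.mem_univ i),
    lmarginal_erase' (μ := fun _ : ι => μ) _ hg (Finset.mem_univ i), h1]
  simp only [lmarginal_update_of_mem _ (Finset.mem_singleton_self i), lintegral_const]
  simp only [lmarginal]
  rw [← lintegral_const_mul _ (by fun_prop)]
  simp only [mul_comm]

end Tonelli

/-! ### Thin neighbourhoods of subspaces -/

/-- Being close to the span of other vertices is an open condition. -/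
theorem isOpen_infDist_affineSpan_lt {E : Type*} [NormedAddCommGroup E]
    [NormedSpace ℝ E] {ι : Type*} [Fintype ι] (S : Set ι)
    (hS : S.Nonempty) (k : ι) (r : ℝ) :
    IsOpen {X : ι → E | Metric.infDist (X k) (affineSpan ℝ (X '' S) : Set E) < r} := by
  classical
  have hset : {X : ι → E | Metric.infDist (X k) (affineSpan ℝ (X '' S) : Set E) < r} =
      ⋃ w : {w : S → ℝ // ∑ i, w i = 1}, {X | dist (X k) (∑ i, w.1 i • X i) < r} := by
    ext X
    have hne : (affineSpan ℝ (X '' S) : Set E).Nonempty :=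
      (affineSpan_nonempty ℝ).2 (hS.image X)
    have hrange : X '' S = Set.range fun i : S => X i := Set.image_eq_range X S
    simp only [Set.mem_ofPred_eq, Set.mem_iUnion]
    rw [Metric.infDist_lt_iff hne, hrange]
    constructor
    · rintro ⟨p, hp, hpr⟩
      obtain ⟨w, hw, rfl⟩ := eq_affineCombination_of_mem_affineSpan_of_fintype hp
      rw [Finset.affineCombination_eq_linear_combination _ _ _ hw] at hpr
      exact ⟨⟨w, hw⟩, hpr⟩
    · rintro ⟨⟨w, hw⟩, h⟩
      refine ⟨_, affineCombination_mem_affineSpan hw _, ?_⟩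
      rwa [Finset.affineCombination_eq_linear_combination _ _ _ hw]
  rw [hset]
  exact isOpen_iUnion fun w => isOpen_lt (by fun_prop) continuous_const

section Regular

variable {H : Type*} [NormedAddCommGroup H] [InnerProductSpace ℝ H]

/-- Two points of the `s`-neighbourhood of an affine subspace whose coordinates along the
subspace lie in the same cell of a grid of mesh `s` have distance at most `(k + 2) * s`. -/
theorem dist_le_of_same_cell {A : AffineSubspace ℝ H} [FiniteDimensional ℝ A.direction]
    (hA : (A : Set H).Nonempty) {k : ℕ} (b : OrthonormalBasis (Fin k) ℝ A.direction)
    {s : ℝ} (hs : 0 < s) {x y z : H} (hy : Metric.infDist y (A : Set H) < s)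
    (hz : Metric.infDist z (A : Set H) < s)
    (h : ∀ i, ⌊inner ℝ (b i : H) (y - x) / s⌋ = ⌊inner ℝ (b i : H) (z - x) / s⌋) :
    dist y z ≤ (k + 2) * s := by
  obtain ⟨p, hp, hyp⟩ := (Metric.infDist_lt_iff hA).1 hy
  obtain ⟨q, hq, hzq⟩ := (Metric.infDist_lt_iff hA).1 hz
  set u := y - z with hu
  have h1 : ‖A.direction.starProjection u‖ ≤ k * s := by
    have hsum : A.direction.starProjection u = ∑ i, inner ℝ (b i : H) u • (b i : H) := by
      rw [b.starProjection_eq_sum_rankOne]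
      simp
    rw [hsum]
    refine (norm_sum_le _ _).trans ?_
    have : ∀ i ∈ Finset.univ, ‖inner ℝ (b i : H) u • (b i : H)‖ ≤ s := fun i _ => by
      have hb : ‖(b i : H)‖ = 1 := b.orthonormal.1 i
      have hfl := Int.abs_sub_lt_one_of_floor_eq_floor (h i)
      rw [← sub_div, ← inner_sub_right, abs_div, abs_of_pos hs, div_lt_one hs] at hfl
      rw [norm_smul, hb, mul_one, Real.norm_eq_abs]
      have : u = y - x - (z - x) := by rw [hu]; abel
      rw [this]
      exact hfl.le
    simpa using Finset.sum_le_card_nsmul _ _ _ this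
  have h2 : ‖u - A.direction.starProjection u‖ ≤ 2 * s := by
    rw [Submodule.starProjection_minimal]
    have hpq : p - q ∈ A.direction := AffineSubspace.vsub_mem_direction hp hq
    refine (ciInf_le ⟨0, by rintro _ ⟨w, rfl⟩; exact norm_nonneg _⟩
      (⟨p - q, hpq⟩ : A.direction)).trans ?_
    have : u - (p - q) = (y - p) - (z - q) := by rw [hu]; abel
    simp only [this]
    refine (norm_sub_le _ _).trans ?_
    rw [← dist_eq_norm, ← dist_eq_norm]
    linarith
  rw [dist_eq_norm, ← hu]
  have h3 := norm_add_le (A.direction.starProjection u) (u - A.direction.starProjection u)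
  rw [add_sub_cancel] at h3
  linarith

variable [MeasurableSpace H] [SecondCountableTopology H] {μ : Measure H} {d : ℕ}

/-- A regular measure gives little mass to a thin neighbourhood of a subspace of dimension
`< d`: at scale `t / N` the neighbourhood is covered by `≲ N ^ (d - 1)` balls, each of mass
`≲ (t / N) ^ d`. -/
theorem IsRegularityBound.measure_slab_le {C : ℝ} (hC : IsRegularityBound d μ C)
    {x : H} {t : ℝ} (ht : 0 < t) (htd : ENNReal.ofReal t ≤ Metric.ediam μ.support)
    {N : ℕ} (hN : d + 1 ≤ N) {A : AffineSubspace ℝ H} (hA : (A : Set H).Nonempty)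
    [FiniteDimensional ℝ A.direction] (hdim : Module.finrank ℝ A.direction + 1 ≤ d) :
    μ (Metric.closedBall x t ∩ {y | Metric.infDist y (A : Set H) < (N : ℝ)⁻¹ * t}) ≤
      ENNReal.ofReal (3 ^ d * (d + 1) ^ d * C * t ^ d / N) := by
  have hN0 : (0 : ℝ) < N := by exact_mod_cast (Nat.succ_pos d).trans_le hN
  set s := (N : ℝ)⁻¹ * t with hs
  have hs0 : 0 < s := by positivity
  set k := Module.finrank ℝ A.direction
  let b := stdOrthonormalBasis ℝ A.direction
  set S := Metric.closedBall x t ∩ {y | Metric.infDist y (A : Set H) < s}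
  let cell : (Fin k → ℤ) → Set H := fun m =>
    S ∩ μ.support ∩ {y | ∀ i, ⌊inner ℝ (b i : H) (y - x) / s⌋ = m i}
  let M : Finset (Fin k → ℤ) := Fintype.piFinset fun _ => Finset.Icc (-(N : ℤ)) N
  have hcover : S ⊆ μ.supportᶜ ∪ ⋃ m ∈ M, cell m := by
    intro y hy
    by_cases hys : y ∈ μ.support
    · refine Or.inr (Set.mem_iUnion₂.2
        ⟨fun i => ⌊inner ℝ (b i : H) (y - x) / s⌋, ?_, ⟨hy, hys⟩, fun i => rfl⟩)
      refine Fintype.mem_piFinset.2 fun i => ?_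
      have hb : ‖(b i : H)‖ = 1 := b.orthonormal.1 i
      have h1 : |inner ℝ (b i : H) (y - x)| ≤ t := by
        refine (abs_real_inner_le_norm _ _).trans ?_
        rw [hb, one_mul, ← dist_eq_norm]
        exact hy.1
      have h2 : |inner ℝ (b i : H) (y - x) / s| ≤ N := by
        rw [abs_div, abs_of_pos hs0, div_le_iff₀ hs0, hs, mul_inv_cancel_left₀ hN0.ne']
        exact h1
      obtain ⟨h3, h4⟩ := abs_le.1 h2
      refine Finset.mem_Icc.2 ⟨Int.le_floor.2 (by push_cast; exact h3), ?_⟩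
      have := (Int.floor_le (inner ℝ (b i : H) (y - x) / s)).trans h4
      exact_mod_cast this
    · exact Or.inl hys
  have hcell : ∀ m ∈ M, μ (cell m) ≤ ENNReal.ofReal (C * ((d + 1) * s) ^ d) := by
    intro m _
    rcases (cell m).eq_empty_or_nonempty with h | ⟨z, hz⟩
    · simp [h]
    have hsub : cell m ⊆ Metric.closedBall z ((d + 1) * s) := by
      intro y hy
      refine Metric.mem_closedBall.2 ((dist_le_of_same_cell hA b hs0 hy.1.1.2 hz.1.1.2
        fun i => (hy.2 i).trans (hz.2 i).symm).trans ?_)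
      have : (k : ℝ) + 1 ≤ d := by exact_mod_cast hdim
      nlinarith
    have hst : (d + 1) * s ≤ t := by
      have h1 : ((d : ℝ) + 1) ≤ N := by exact_mod_cast hN
      rw [hs, ← mul_assoc, ← div_eq_mul_inv]
      exact mul_le_of_le_one_left ht.le ((div_le_one hN0).2 h1)
    exact (measure_mono hsub).trans (hC.2 z hz.1.2 _ (by positivity)
      ((ENNReal.ofReal_le_ofReal hst).trans htd)).2
  have hcard : (M.card : ℝ) ≤ (3 * N) ^ (d - 1) := by
    have h1 : M.card = (2 * N + 1) ^ k := by
      simp only [M, Fintype.card_piFinset, Int.card_Icc, Finset.prod_const, Finset.card_univ,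
        Fintype.card_fin]
      congr 1
      omega
    have h2 : (1 : ℝ) ≤ N := by exact_mod_cast (Nat.succ_pos d).trans_le hN
    rw [h1]
    push_cast
    calc (2 * (N : ℝ) + 1) ^ k ≤ (3 * N) ^ k := by gcongr; linarith
      _ ≤ (3 * N) ^ (d - 1) := by
        gcongr
        · linarith
        · omega
  have hC0 : 0 ≤ C := zero_le_one.trans hC.1
  calc μ S ≤ μ (μ.supportᶜ ∪ ⋃ m ∈ M, cell m) := measure_mono hcover
    _ ≤ μ μ.supportᶜ + μ (⋃ m ∈ M, cell m) := measure_union_le _ _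
    _ = μ (⋃ m ∈ M, cell m) := by rw [Measure.measure_compl_support, zero_add]
    _ ≤ ∑ m ∈ M, μ (cell m) := measure_biUnion_finset_le _ _
    _ ≤ M.card • ENNReal.ofReal (C * ((d + 1) * s) ^ d) := Finset.sum_le_card_nsmul _ _ _ hcell
    _ = ENNReal.ofReal (M.card * (C * ((d + 1) * s) ^ d)) := by
      rw [nsmul_eq_mul, ENNReal.ofReal_mul (Nat.cast_nonneg _), ENNReal.ofReal_natCast]
    _ ≤ _ := by
      refine ENNReal.ofReal_le_ofReal ?_
      have hd : d = d - 1 + 1 := by omega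
      calc (M.card : ℝ) * (C * ((d + 1) * s) ^ d)
          ≤ (3 * N) ^ (d - 1) * (C * ((d + 1) * s) ^ d) := by gcongr
        _ ≤ 3 * ((3 * N) ^ (d - 1) * (C * ((d + 1) * s) ^ d)) :=
          le_mul_of_one_le_left (by positivity) (by norm_num)
        _ = 3 ^ d * (d + 1) ^ d * C * t ^ d / N := by
          rw [hs, mul_pow, mul_pow, mul_pow, inv_pow]
          have e1 : (3 : ℝ) ^ d = 3 ^ (d - 1) * 3 := by rw [← pow_succ, ← hd]
          have e2 : (N : ℝ) ^ d = N ^ (d - 1) * N := by rw [← pow_succ, ← hd]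
          rw [e1, e2]
          field_simp

end Regular

/-! ### Measurability, and integration over spread simplices -/

section Measurability

theorem measurableSet_bigSimplices {d : ℕ} {E : Type*} [NormedAddCommGroup E]
    [MeasurableSpace E] [BorelSpace E] [SecondCountableTopology E] (x : E) (t lam : ℝ) :
    MeasurableSet (bigSimplices d x t lam) := by
  have hset : bigSimplices d x t lam = (⋂ i, {X | dist (X i) x ≤ t}) ∩
      ⋂ p, ⋂ q, ⋂ (_ : p ≠ q), {X | lam * t ≤ dist (X p) (X q)} := by
    ext X
    simp [bigSimplices, le_minEdge_iff]
  rw [hset]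
  refine IsClosed.measurableSet (IsClosed.inter (isClosed_iInter fun i => ?_)
    (isClosed_iInter fun p => isClosed_iInter fun q => isClosed_iInter fun _ => ?_))
  · exact isClosed_le (by fun_prop) continuous_const
  · exact isClosed_le continuous_const (by fun_prop)

theorem isClosed_setOf_isSpread {E : Type*} [NormedAddCommGroup E] [InnerProductSpace ℝ E]
    {d : ℕ} (hd : 1 ≤ d) (r : ℝ) :
    IsClosed {X : Fin (d + 2) → E | IsSpread r X} := by
  have hset : {X : Fin (d + 2) → E | IsSpread r X} = ⋂ k, ⋂ j, ⋂ (_ : k ≠ j),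
      {X | Metric.infDist (X k) (affineSpan ℝ (X '' {k, j}ᶜ) : Set E) < r}ᶜ := by
    ext X
    simp [IsSpread]
  rw [hset]
  refine isClosed_iInter fun k => isClosed_iInter fun j => isClosed_iInter fun _ => ?_
  obtain ⟨i, hik, hij⟩ := exists_ne_ne hd k j
  exact (isOpen_infDist_affineSpan_lt _ ⟨i, by simp [hik, hij]⟩ k r).isClosed_compl

variable {H : Type*} [NormedAddCommGroup H] [InnerProductSpace ℝ H] [MeasurableSpace H]
  [BorelSpace H] [SecondCountableTopology H] {d : ℕ}

theorem measurable_content {n : ℕ} : Measurable (content : (Fin (n + 1) → H) → ℝ) := by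
  have hgram : Continuous fun X : Fin (n + 1) → H =>
      Matrix.gram ℝ fun i : Fin n => X i.succ - X 0 :=
    continuous_matrix fun i j => by
      simp only [Matrix.gram_apply]
      fun_prop
  exact (Real.continuous_sqrt.comp hgram.matrix_det).measurable

theorem measurable_mengerCurv : Measurable (mengerCurv : (Fin (d + 2) → H) → ℝ) := by
  have hmax : Measurable (maxEdge : (Fin (d + 2) → H) → ℝ) :=
    Measurable.iSup fun p => (by fun_prop : Continuous fun X : Fin (d + 2) → H =>
      dist (X p.1) (X p.2)).measurable
  have hsin : ∀ i, Measurable fun X : Fin (d + 2) → H => polarSine X i := fun i =>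
    measurable_content.div (by fun_prop : Continuous fun X : Fin (d + 2) → H =>
      ∏ j ∈ Finset.univ.erase i, ‖X j - X i‖).measurable
  unfold mengerCurv
  fun_prop

theorem measurable_curvIntegrand (x : H) (t lam : ℝ) :
    Measurable (curvIntegrand d x t lam) :=
  (measurable_mengerCurv.pow_const 2).ennreal_ofReal.indicator (measurableSet_bigSimplices x t lam)

variable {μ : Measure H}

/-- With respect to the product of the restrictions of a regular measure to a ball, few tuples
have their `k`-th vertex close to the span of the vertices other than `k` and `j`. -/
theorem IsRegularityBound.measure_close_le (hd : 1 ≤ d) {C : ℝ} (hC : IsRegularityBound d μ C)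
    {x : H} {t : ℝ} (ht : 0 < t) (htd : ENNReal.ofReal t ≤ Metric.ediam μ.support)
    (hb0 : μ (Metric.closedBall x t) ≠ 0) (hb : μ (Metric.closedBall x t) ≠ ∞)
    {N : ℕ} (hN : d + 1 ≤ N) {k j : Fin (d + 2)} (hkj : k ≠ j) :
    Measure.pi (fun _ : Fin (d + 2) => μ.restrict (Metric.closedBall x t))
        {X | Metric.infDist (X k) (affineSpan ℝ (X '' {k, j}ᶜ) : Set H) < (N : ℝ)⁻¹ * t} ≤
      ENNReal.ofReal (3 ^ d * (d + 1) ^ d * C * t ^ d / N) *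
        μ (Metric.closedBall x t) ^ (d + 1) := by
  set b := μ (Metric.closedBall x t)
  set ν := μ.restrict (Metric.closedBall x t) with hν
  have hνu : ν Set.univ = b := by rw [hν, Measure.restrict_apply_univ]
  have hfin : IsFiniteMeasure ν := ⟨by rw [hνu]; exact hb.lt_top⟩
  obtain ⟨o, hok, hoj⟩ := exists_ne_ne hd k j
  set B := {X : Fin (d + 2) → H |
    Metric.infDist (X k) (affineSpan ℝ (X '' {k, j}ᶜ) : Set H) < (N : ℝ)⁻¹ * t}
  have hB : MeasurableSet B :=
    (isOpen_infDist_affineSpan_lt _ ⟨o, by simp [hok, hoj]⟩ k _).measurableSet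
  set m := ENNReal.ofReal (3 ^ d * (d + 1) ^ d * C * t ^ d / N)
  have hsec : ∀ X : Fin (d + 2) → H,
      ∫⁻ y, B.indicator 1 (Function.update X k y) ∂ν ≤ m := by
    intro X
    have himg : ∀ y, Function.update X k y '' {k, j}ᶜ = X '' {k, j}ᶜ := fun y =>
      Set.image_congr fun i hi => Function.update_of_ne (fun h => hi (Or.inl h)) _ _
    have hind : ∀ y, B.indicator (1 : (Fin (d + 2) → H) → ℝ≥0∞) (Function.update X k y) =
        {y | Metric.infDist y (affineSpan ℝ (X '' {k, j}ᶜ) : Set H) <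
          (N : ℝ)⁻¹ * t}.indicator 1 y := by
      intro y
      simp only [Set.indicator_apply, B, Set.mem_ofPred_eq, himg, Function.update_self,
        Pi.one_apply]
    have hmeas : MeasurableSet
        {y | Metric.infDist y (affineSpan ℝ (X '' {k, j}ᶜ) : Set H) < (N : ℝ)⁻¹ * t} :=
      (isOpen_lt (Metric.continuous_infDist_pt _) continuous_const).measurableSet
    simp only [hind]
    rw [lintegral_indicator_one hmeas, hν, Measure.restrict_apply hmeas, Set.inter_comm]
    have hrange : X '' {k, j}ᶜ = Set.range fun i : ({k, j}ᶜ : Set (Fin (d + 2))) => X i :=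
      Set.image_eq_range X _
    have hfd : FiniteDimensional ℝ (affineSpan ℝ (X '' {k, j}ᶜ)).direction := by
      rw [direction_affineSpan, hrange]
      exact finiteDimensional_vectorSpan_range ℝ _
    refine hC.measure_slab_le ht htd hN
      ((affineSpan_nonempty ℝ).2 ⟨X o, o, by simp [hok, hoj], rfl⟩) ?_
    rw [direction_affineSpan, hrange]
    have hcard : Fintype.card ({k, j}ᶜ : Set (Fin (d + 2))) = d - 1 + 1 := by
      have h1 : Fintype.card ({k, j} : Set (Fin (d + 2))) = 2 := by
        rw [Set.card_insert _ (by simpa using hkj)]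
        simp
      rw [Fintype.card_compl_set, h1, Fintype.card_fin]
      omega
    have := finrank_vectorSpan_range_le ℝ
      (fun i : ({k, j}ᶜ : Set (Fin (d + 2))) => X i) hcard
    omega
  have h1 := lintegral_pi_lintegral_update ν
    (measurable_one.indicator hB : Measurable (B.indicator (1 : (Fin (d + 2) → H) → ℝ≥0∞))) k
  rw [lintegral_indicator_one hB, hνu] at h1
  have h2 : b * Measure.pi (fun _ : Fin (d + 2) => ν) B ≤ b * (m * b ^ (d + 1)) := by
    rw [← h1]
    refine (lintegral_mono hsec).trans_eq ?_
    rw [lintegral_const, Measure.pi_univ]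
    simp only [hνu, Finset.prod_const, Finset.card_univ, Fintype.card_fin]
    ring
  exact (ENNReal.mul_le_mul_iff_right hb0 hb).1 h2

/-- At least half of the `(d + 2)`-tuples in a ball are spread, at a scale depending only on `d`
and the regularity constant. -/
theorem IsRegularityBound.half_le_measure_isSpread (hd : 1 ≤ d) {C : ℝ}
    (hC : IsRegularityBound d μ C) {x : H} (hx : x ∈ μ.support) {t : ℝ} (ht : 0 < t)
    (htd : ENNReal.ofReal t ≤ Metric.ediam μ.support) {N : ℕ} (hN : d + 1 ≤ N)
    (hNC : 2 * (d + 2) ^ 2 * (3 ^ d * (d + 1) ^ d) * C ^ 2 ≤ N) :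
    μ (Metric.closedBall x t) ^ (d + 2) / 2 ≤
      Measure.pi (fun _ : Fin (d + 2) => μ.restrict (Metric.closedBall x t))
        {X | IsSpread ((N : ℝ)⁻¹ * t) X} := by
  obtain ⟨hlow, hupp⟩ := hC.2 x hx t ht htd
  have hC0 : 0 < C := zero_lt_one.trans_le hC.1
  have hN0 : (0 : ℝ) < N := by exact_mod_cast (Nat.succ_pos d).trans_le hN
  have hb : μ (Metric.closedBall x t) ≠ ∞ := (hupp.trans_lt ENNReal.ofReal_lt_top).ne
  have hb0 : μ (Metric.closedBall x t) ≠ 0 :=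
    ((ENNReal.ofReal_pos.2 (by positivity)).trans_le hlow).ne'
  have hclose : ∀ p : {p : Fin (d + 2) × Fin (d + 2) // p.1 ≠ p.2}, _ := fun p =>
    hC.measure_close_le hd ht htd hb0 hb hN p.2
  set b := μ (Metric.closedBall x t)
  set ν := μ.restrict (Metric.closedBall x t) with hν
  have hνu : ν Set.univ = b := by rw [hν, Measure.restrict_apply_univ]
  have hfin : IsFiniteMeasure ν := ⟨by rw [hνu]; exact hb.lt_top⟩
  set m := ENNReal.ofReal (3 ^ d * (d + 1) ^ d * C * t ^ d / N)
  set E := {X : Fin (d + 2) → H | IsSpread ((N : ℝ)⁻¹ * t) X}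
  have hcover : (Set.univ : Set (Fin (d + 2) → H)) ⊆ E ∪
      ⋃ p : {p : Fin (d + 2) × Fin (d + 2) // p.1 ≠ p.2},
        {X | Metric.infDist (X p.1.1) (affineSpan ℝ (X '' {p.1.1, p.1.2}ᶜ) : Set H) <
          (N : ℝ)⁻¹ * t} := by
    intro X _
    by_cases h : IsSpread ((N : ℝ)⁻¹ * t) X
    · exact Or.inl h
    · unfold IsSpread at h
      push Not at h
      obtain ⟨k, j, hkj, h⟩ := h
      exact Or.inr (Set.mem_iUnion.2 ⟨⟨(k, j), hkj⟩, h⟩)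
  have hcard : Fintype.card {p : Fin (d + 2) × Fin (d + 2) // p.1 ≠ p.2} ≤ (d + 2) ^ 2 := by
    refine (Fintype.card_subtype_le _).trans_eq ?_
    simp [sq]
  -- the scale is chosen so that the union bound costs at most half of the total mass
  have hm : ((d + 2) ^ 2 : ℕ) * m ≤ b / 2 := by
    rw [ENNReal.le_div_iff_mul_le (by simp) (by simp)]
    refine le_trans ?_ hlow
    rw [← ENNReal.ofReal_natCast, ← ENNReal.ofReal_ofNat 2, ← ENNReal.ofReal_mul (by positivity),
      ← ENNReal.ofReal_mul (by positivity)]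
    refine ENNReal.ofReal_le_ofReal ?_
    push_cast
    rw [← mul_div_assoc, div_mul_eq_mul_div, div_le_iff₀ hN0]
    calc ((d : ℝ) + 2) ^ 2 * (3 ^ d * (d + 1) ^ d * C * t ^ d) * 2
        = C⁻¹ * t ^ d * (2 * (d + 2) ^ 2 * (3 ^ d * (d + 1) ^ d) * C ^ 2) := by
          field_simp
      _ ≤ C⁻¹ * t ^ d * N := by gcongr
  have htotal : b ^ (d + 2) / 2 + b ^ (d + 2) / 2 ≤
      Measure.pi (fun _ : Fin (d + 2) => ν) E + b ^ (d + 2) / 2 := by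
    calc b ^ (d + 2) / 2 + b ^ (d + 2) / 2
        = Measure.pi (fun _ : Fin (d + 2) => ν) Set.univ := by
          rw [ENNReal.add_halves, Measure.pi_univ]
          simp [hνu]
      _ ≤ Measure.pi (fun _ : Fin (d + 2) => ν) E +
          ∑ p : {p : Fin (d + 2) × Fin (d + 2) // p.1 ≠ p.2},
            Measure.pi (fun _ : Fin (d + 2) => ν)
              {X | Metric.infDist (X p.1.1) (affineSpan ℝ (X '' {p.1.1, p.1.2}ᶜ) : Set H) <
                (N : ℝ)⁻¹ * t} :=
          (measure_mono hcover).trans ((measure_union_le _ _).trans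
            (add_le_add le_rfl (measure_iUnion_fintype_le _ _)))
      _ ≤ Measure.pi (fun _ : Fin (d + 2) => ν) E + ((d + 2) ^ 2 : ℕ) * (m * b ^ (d + 1)) := by
          gcongr
          refine (Finset.sum_le_card_nsmul _ _ _ fun p _ => hclose p).trans ?_
          rw [nsmul_eq_mul, Finset.card_univ]
          gcongr
      _ = Measure.pi (fun _ : Fin (d + 2) => ν) E + (((d + 2) ^ 2 : ℕ) * m) * b ^ (d + 1) := by
          rw [mul_assoc]
      _ ≤ Measure.pi (fun _ : Fin (d + 2) => ν) E + b / 2 * b ^ (d + 1) := by gcongr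
      _ = Measure.pi (fun _ : Fin (d + 2) => ν) E + b ^ (d + 2) / 2 := by
          rw [pow_succ' b (d + 1), ENNReal.mul_div_right_comm]
  exact (ENNReal.add_le_add_iff_right
    (ENNReal.div_ne_top (ENNReal.pow_ne_top hb) (by simp))).1 htotal

/-- Integrating the pointwise comparison over all spread tuples. -/
theorem mul_measure_isSpread_le (hd : 1 ≤ d) [SigmaFinite μ] {x : H} {t δ : ℝ}
    (ht : 0 < t) (hδ : 0 < δ) (hb : μ (Metric.closedBall x t) ≠ ∞)
    {T : ℝ≥0∞} (hT : ∀ L : AffineSubspace ℝ H, IsPlane d L →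
      T ≤ ∫⁻ y in Metric.closedBall x t,
        ENNReal.ofReal ((Metric.infDist y (L : Set H) / (2 * t)) ^ 2) ∂μ) :
    T * Measure.pi (fun _ : Fin (d + 2) => μ.restrict (Metric.closedBall x t))
        {X | IsSpread (δ * t) X} ≤
      ENNReal.ofReal ((2 + 32 / δ ^ 2) * facetConst d t δ) * ((d + 3 : ℕ) *
        (μ (Metric.closedBall x t) * mengerCurvSq d μ x t (δ / 2))) := by
  set B := Metric.closedBall x t with hBdef
  set ν := μ.restrict B with hν
  have hνu : ν Set.univ = μ B := by rw [hν, Measure.restrict_apply_univ]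
  have hfin : IsFiniteMeasure ν := ⟨by rw [hνu]; exact hb.lt_top⟩
  set π := Measure.pi (fun _ : Fin (d + 2) => ν) with hπ
  have hres : π = (Measure.pi fun _ : Fin (d + 2) => μ).restrict (Set.univ.pi fun _ => B) :=
    (Measure.restrict_pi_pi (fun _ : Fin (d + 2) => μ) fun _ => B).symm
  have hBall : ∀ᵐ X ∂π, ∀ i, X i ∈ B := by
    rw [hres]
    filter_upwards [ae_restrict_mem (MeasurableSet.univ_pi fun _ =>
      (Metric.isClosed_closedBall.measurableSet : MeasurableSet B))] with X hX i
    exact hX i (Set.mem_univ i)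
  set E := {X : Fin (d + 2) → H | IsSpread (δ * t) X}
  have hE : MeasurableSet E := (isClosed_setOf_isSpread hd _).measurableSet
  set g := curvIntegrand d x t (δ / 2)
  have hg : Measurable g := measurable_curvIntegrand x t _
  set K := ENNReal.ofReal ((2 + 32 / δ ^ 2) * facetConst d t δ)
  have hupd : ∀ (X : Fin (d + 2) → H) j, Measurable fun y => g (Function.update X j y) :=
    fun X j => hg.comp (measurable_update X)
  have hpoint : ∀ᵐ X ∂π.restrict E,
      T ≤ K * (μ B * g X + ∑ j, ∫⁻ y, g (Function.update X j y) ∂ν) := by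
    rw [ae_restrict_iff' hE]
    filter_upwards [hBall] with X hXB hX
    refine (hT _ (IsSpread.isPlane (mul_pos hδ ht) hX (Fin.last (d + 1)))).trans ?_
    calc ∫⁻ y in B, ENNReal.ofReal ((Metric.infDist y
          (affineSpan ℝ (X '' {Fin.last (d + 1)}ᶜ) : Set H) / (2 * t)) ^ 2) ∂μ
        ≤ ∫⁻ y, K * (g X + ∑ j, g (Function.update X j y)) ∂ν :=
          setLIntegral_mono' Metric.isClosed_closedBall.measurableSet fun y hy =>
            IsSpread.ofReal_infDist_le hd ht hδ hX hXB hy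
      _ = K * (μ B * g X + ∑ j, ∫⁻ y, g (Function.update X j y) ∂ν) := by
          rw [lintegral_const_mul' _ _ ENNReal.ofReal_ne_top,
            lintegral_add_left measurable_const, lintegral_const, hνu,
            lintegral_finsetSum _ fun j _ => hupd X j, mul_comm (g X)]
  have hsum : ∀ j, ∫⁻ X, ∫⁻ y, g (Function.update X j y) ∂ν ∂π = μ B * ∫⁻ X, g X ∂π := fun j => by
    rw [← hνu]
    exact lintegral_pi_lintegral_update ν hg j
  have hle : ∫⁻ X, g X ∂π ≤ mengerCurvSq d μ x t (δ / 2) := by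
    rw [mengerCurvSq, ← lintegral_indicator (measurableSet_bigSimplices x t _), hres]
    exact lintegral_mono' Measure.restrict_le_self le_rfl
  have hinner : ∀ j, Measurable fun X : Fin (d + 2) → H =>
      ∫⁻ y, g (Function.update X j y) ∂ν := fun j => by
    refine Measurable.lintegral_prod_right' (f := fun p : (Fin (d + 2) → H) × H =>
      g (Function.update p.1 j p.2)) (hg.comp ?_)
    exact measurable_update'
  calc T * π E = ∫⁻ _ in E, T ∂π := (setLIntegral_const _ _).symm
    _ ≤ ∫⁻ X in E, K * (μ B * g X + ∑ j, ∫⁻ y, g (Function.update X j y) ∂ν) ∂π :=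
        lintegral_mono_ae hpoint
    _ ≤ ∫⁻ X, K * (μ B * g X + ∑ j, ∫⁻ y, g (Function.update X j y) ∂ν) ∂π :=
        setLIntegral_le_lintegral _ _
    _ = K * ((d + 3 : ℕ) * (μ B * ∫⁻ X, g X ∂π)) := by
        rw [lintegral_const_mul' _ _ ENNReal.ofReal_ne_top,
          lintegral_add_left (hg.const_mul _), lintegral_const_mul _ hg,
          lintegral_finsetSum _ fun j _ => hinner j]
        simp only [hsum, Finset.sum_const, Finset.card_univ, Fintype.card_fin, nsmul_eq_mul]
        push_cast
        ring
    _ ≤ _ := by gcongr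

end Measurability

end MengerCurvature

/-! ### The comparison of `betaTwo` with the curvature -/

theorem theorem1p2 (d : ℕ) (hd : 1 ≤ d) (C : ℝ) :
    ∃ lam₀ C₁ : ℝ, 0 < lam₀ ∧ lam₀ < 2 ∧ 1 ≤ C₁ ∧
      ∀ (H : Type*) [NormedAddCommGroup H] [InnerProductSpace ℝ H] [CompleteSpace H]
        [TopologicalSpace.SeparableSpace H] [MeasurableSpace H] [BorelSpace H],
        (d : Cardinal) < Module.rank ℝ H →
        ∀ μ : Measure H, MengerCurvature.IsDRegular d μ →
          MengerCurvature.regularityConst d μ = C →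
          ∀ x ∈ μ.support, ∀ t : ℝ, 0 < t → ENNReal.ofReal t ≤ Metric.ediam μ.support →
            MengerCurvature.betaTwo d μ x t ^ 2 * μ (Metric.closedBall x t) ≤
              ENNReal.ofReal C₁ * MengerCurvature.mengerCurvSq d μ x t lam₀ := by
  open MengerCurvature in
  obtain ⟨N, hN⟩ := exists_nat_ge
    (max ((d : ℝ) + 1) (2 * (d + 2) ^ 2 * (3 ^ d * (d + 1) ^ d) * C ^ 2))
  have hNd : d + 1 ≤ N := by exact_mod_cast (le_max_left _ _).trans hN
  have hNC := (le_max_right _ _).trans hN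
  have hN1 : (1 : ℝ) ≤ N := by exact_mod_cast (Nat.succ_pos d).trans_le hNd
  have hN0 : (0 : ℝ) < N := zero_lt_one.trans_le hN1
  -- simplices are spread at scale `δ * t`; half of that leaves room for one replaced vertex
  set δ : ℝ := (N : ℝ)⁻¹ with hδdef
  have hδ : 0 < δ := inv_pos.2 hN0
  have hδ1 : δ ≤ 1 := inv_le_one_of_one_le₀ hN1
  refine ⟨δ / 2, max 1 (2 * (d + 3) * C ^ (d + 1) * ((2 + 32 / δ ^ 2) * facetConst d 1 δ)),
    by positivity, by linarith, le_max_left _ _, ?_⟩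
  intro H _ _ _ _ _ _ _ μ hμ hμC x hx t ht htd
  have hsec : SecondCountableTopology H := UniformSpace.secondCountable_of_separable H
  have hloc := hμ.locallyFinite
  have hC : IsRegularityBound d μ C := hμC ▸ (isLeast_regularityConst hμ).1
  have hC0 : 0 < C := zero_lt_one.trans_le hC.1
  obtain ⟨hlow, hupp⟩ := hC.2 x hx t ht htd
  have hb : μ (Metric.closedBall x t) ≠ ∞ := (hupp.trans_lt ENNReal.ofReal_lt_top).ne
  have hb0 : μ (Metric.closedBall x t) ≠ 0 :=
    ((ENNReal.ofReal_pos.2 (by positivity)).trans_le hlow).ne'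
  set T := betaTwo d μ x t ^ 2 * μ (Metric.closedBall x t) with hTdef
  have hT : ∀ L : AffineSubspace ℝ H, IsPlane d L →
      T ≤ ∫⁻ y in Metric.closedBall x t,
        ENNReal.ofReal ((Metric.infDist y (L : Set H) / (2 * t)) ^ 2) ∂μ := by
    intro L hL
    rw [hTdef, betaTwo, if_neg hb0, ← ENNReal.rpow_natCast, ← ENNReal.rpow_mul]
    norm_num
    exact (ENNReal.le_div_iff_mul_le (Or.inl hb0) (Or.inl hb)).1
      (iInf_le _ (⟨L, hL⟩ : {L : AffineSubspace ℝ H // IsPlane d L}))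
  have hmain := mul_measure_isSpread_le hd ht hδ hb hT
  have hhalf := hC.half_le_measure_isSpread hd hx ht htd hNd hNC
  set b := μ (Metric.closedBall x t)
  set I := mengerCurvSq d μ x t (δ / 2)
  set K := (2 + 32 / δ ^ 2) * facetConst d 1 δ with hK
  have hK0 : 0 ≤ K := by unfold K facetConst; positivity
  have hKt : (2 + 32 / δ ^ 2) * facetConst d t δ = K * t ^ (d * (d + 1)) := by
    rw [hK, facetConst, facetConst, one_pow]
    ring
  rw [hKt] at hmain
  have h1 : T * b ^ (d + 1) ≤ ENNReal.ofReal (2 * (d + 3) * K * t ^ (d * (d + 1))) * I := by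
    have h2 : b * (T * b ^ (d + 1)) ≤
        b * (ENNReal.ofReal (2 * (d + 3) * K * t ^ (d * (d + 1))) * I) := by
      calc b * (T * b ^ (d + 1)) = 2 * (T * (b ^ (d + 2) / 2)) := by
            rw [mul_left_comm 2, ENNReal.mul_div_cancel (by simp) (by simp)]
            ring
        _ ≤ 2 * (ENNReal.ofReal (K * t ^ (d * (d + 1))) * ((d + 3 : ℕ) * (b * I))) := by
            exact mul_le_mul' le_rfl ((mul_le_mul' le_rfl hhalf).trans hmain)
        _ = b * (ENNReal.ofReal (2 * (d + 3) * K * t ^ (d * (d + 1))) * I) := by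
            have : ENNReal.ofReal (2 * (d + 3) * K * t ^ (d * (d + 1))) =
                2 * (d + 3 : ℕ) * ENNReal.ofReal (K * t ^ (d * (d + 1))) := by
              rw [mul_assoc (2 * ((d : ℝ) + 3)), ENNReal.ofReal_mul (by positivity),
                ENNReal.ofReal_mul (by positivity), ENNReal.ofReal_ofNat,
                ← ENNReal.ofReal_natCast]
              push_cast
              rfl
            rw [this]
            ring
    exact (ENNReal.mul_le_mul_iff_right hb0 hb).1 h2
  have h3 : T * ENNReal.ofReal ((C⁻¹ * t ^ d) ^ (d + 1)) ≤
      ENNReal.ofReal (2 * (d + 3) * K * t ^ (d * (d + 1))) * I := by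
    rw [ENNReal.ofReal_pow (by positivity)]
    refine le_trans ?_ h1
    gcongr
  have hpos : (0 : ℝ) < (C⁻¹ * t ^ d) ^ (d + 1) := by positivity
  have h4 : T * ENNReal.ofReal ((C⁻¹ * t ^ d) ^ (d + 1)) ≤
      ENNReal.ofReal (2 * (d + 3) * C ^ (d + 1) * K) * I *
        ENNReal.ofReal ((C⁻¹ * t ^ d) ^ (d + 1)) := by
    refine h3.trans_eq ?_
    rw [mul_right_comm _ I, ← ENNReal.ofReal_mul (by positivity)]
    congr 2
    rw [mul_pow, inv_pow, ← pow_mul]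
    field_simp
  refine ((ENNReal.mul_le_mul_iff_left (ENNReal.ofReal_pos.2 hpos).ne'
    ENNReal.ofReal_ne_top).1 h4).trans ?_
  gcongr
  exact le_max_right _ _
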